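/- Let $G$ be a discrete group and let $EG\to BG$ be a universal principal $G$-bundle, i.e. $EG$ is a contractible space with a $G$-action for which $EG\to EG/G$ is a principal $G$-bundle. For a $G$-space $X$ let $EG\times_G X$ be the quotient of $EG\times X$ by the diagonal $G$-action, and for a space $Y$ let $LY$ be the space of continuous maps $S^1\to Y$ with the compact-open topology. For a space $M$ on which $G$ acts by homeomorphisms put $$\mathcal P_g(M)=\{\gamma:[0,1]\to M \text{ continuous}\mid \gamma(1)=g\gamma(0)\}\subset M^{[0,1]},\qquad \mathcal P_G(M)=\coprod_{g\in G}\mathcal P_g(M)\times\{g\},$$ where path spaces carry the compact-open topology and $G$ acts on $\mathcal P_G(M)$ by $h\cdot(\gamma,g)=(h\gamma,hgh^{-1})$. Let $p:M\to M/G$ be the projection and let $\overline p:EG\times_G\mathcal P_G(M)\to L(M/G)$ be the map sending $[e,(\gamma,g)]$ to the loop $p\circ\gamma$. (1) If $p:M\to M/G$ is a principal $G$-bundle, then $\overline p:EG\times_G\mathcal P_G(M)\to L(M/G)$ is a weak homotopy equivalence. (2) For every space $M$ on which $G$ acts by homeomorphisms, both maps in $$EG\times_G\mathcal P_G(M)\xleftarrow{\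 \widetilde{p_2}\ }EG\times_G\mathcal P_G(EG\times M)\xrightarrow{\ \overline p\ }L(EG\times_G M)$$ are weak homotopy equivalences, where $\widetilde{p_2}$ is induced by the second projection $p_2:EG\times M\to M$ and $\overline p$ is the map above for the $G$-space $EG\times M$. In particular, $EG\times_G\mathcal P_G(M)$ and $L(EG\times_G M)$ are weakly homotopy equivalent. -/

import Mathlib

open scoped unitInterval Topology

/-! ### Weak homotopy equivalences -/

/-- The map `π₀(X) → π₀(Y)` on path components induced by a continuous map. -/
def pathComponentsMap {X Y : Type*} [TopologicalSpace X] [TopologicalSpace Y] (f : C(X, Y)) :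
    ZerothHomotopy X → ZerothHomotopy Y :=
  Quotient.map f fun _ _ h => h.map f.continuous

/-- Postcomposition of an `n`-dimensional based cube with a continuous map. -/
def genLoopMap {X Y : Type*} [TopologicalSpace X] [TopologicalSpace Y] (f : C(X, Y)) (n : ℕ)
    (x : X) (a : GenLoop (Fin n) X x) : GenLoop (Fin n) Y (f x) :=
  ⟨f.comp a.1, fun y hy => congrArg f (a.2 y hy)⟩

/-- The map `πₙ(X, x) → πₙ(Y, f x)` induced by a continuous map. -/
def homotopyGroupMap {X Y : Type*} [TopologicalSpace X] [TopologicalSpace Y] (f : C(X, Y))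
    (n : ℕ) (x : X) : HomotopyGroup.Pi n X x → HomotopyGroup.Pi n Y (f x) :=
  Quotient.map (genLoopMap f n x) fun _ _ h =>
    ContinuousMap.HomotopicRel.comp_continuousMap h f

/-- A continuous map is a weak homotopy equivalence if it induces a bijection on path components
and bijections on all homotopy groups `πₙ`, `n ≥ 1`, at all base points. -/
structure IsWeakHomotopyEquiv {X Y : Type*} [TopologicalSpace X] [TopologicalSpace Y]
    (f : C(X, Y)) : Prop where
  bijective_pathComponents : Function.Bijective (pathComponentsMap f)
  bijective_homotopyGroup : ∀ (n : ℕ), 1 ≤ n → ∀ x : X,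
    Function.Bijective (homotopyGroupMap f n x)

/-! ### Principal bundles with discrete structure group, and universal bundles -/

section Principal

variable (G : Type*) [Group G]

/-- The orbit space `M/G`, with the quotient topology. -/
abbrev OrbitSpace (M : Type*) [MulAction G M] : Type _ := MulAction.orbitRel.Quotient G M

/-- The projection `p : M → M/G`. -/
def orbitProj (M : Type*) [TopologicalSpace M] [MulAction G M] : C(M, OrbitSpace G M) :=
  ⟨Quotient.mk _, continuous_quotient_mk'⟩

/-- For the discrete group `G` acting on `M`, the projection `M → M/G` is a principal `G`-bundle:
`G` acts by homeomorphisms and every point has a neighbourhood `U` whose translates are pairwise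
disjoint, so that `G × U ≃ ⋃ g, g • U` is an equivariant local trivialization. -/
def IsPrincipalBundle (M : Type*) [TopologicalSpace M] [MulAction G M] : Prop :=
  IsQuotientCoveringMap (orbitProj G M) G

/-- `E` is (a model of) `EG`, the total space of a universal principal `G`-bundle
`G → EG → BG`: the projection `E → E/G` is a principal `G`-bundle and `E` is contractible. -/
structure IsUniversalBundle (E : Type*) [TopologicalSpace E] [MulAction G E] : Prop where
  isPrincipalBundle : IsPrincipalBundle G E
  contractible : ContractibleSpace E

end Principal

/-! ### Existence of universal bundles -/

section Existence

open MeasureTheory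

/-- A model of `EG`, showing that universal bundles exist: simple functions `[0, 1] → G` with
pointwise left translation; the distance of two functions is the measure of the set on which they
differ. (The points of the bar construction are the step functions with value `gᵢ` on an interval
of length `tᵢ`.) -/
def StepSpace (G : Type*) : Type _ := SimpleFunc I G

namespace StepSpace

variable {G : Type*}

/-- The set on which two step functions differ. -/
def diffSet (a b : StepSpace G) : Set I := {x | SimpleFunc.toFun a x ≠ SimpleFunc.toFun b x}

noncomputable instance : PseudoMetricSpace (StepSpace G) where
  dist a b := volume.real (diffSet a b)
  dist_self a := by simp [diffSet]
  dist_comm a b := by simp [diffSet, ne_comm]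
  dist_triangle a b c := by
    refine le_trans (measureReal_mono (s₂ := diffSet a b ∪ diffSet b c) ?_)
      (measureReal_union_le _ _)
    intro x hx
    by_contra h
    simp only [diffSet, Set.mem_union, Set.mem_ofPred_eq, not_or, not_not] at h
    exact hx (h.1.trans h.2)

theorem dist_def (a b : StepSpace G) : dist a b = volume.real (diffSet a b) := rfl

variable [Group G]

instance : MulAction G (StepSpace G) where
  smul g a := SimpleFunc.map (g * ·) a
  one_smul a := SimpleFunc.ext fun x => one_mul (SimpleFunc.toFun a x)
  mul_smul g h a := SimpleFunc.ext fun x => mul_assoc g h (SimpleFunc.toFun a x)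

theorem smul_apply (g : G) (a : StepSpace G) (x : I) :
    SimpleFunc.toFun (g • a) x = g * SimpleFunc.toFun a x := rfl

theorem dist_smul_smul (g : G) (a b : StepSpace G) : dist (g • a) (g • b) = dist a b := by
  simp [dist_def, diffSet, smul_apply]

theorem dist_smul_self {g : G} (hg : g ≠ 1) (a : StepSpace G) : dist (g • a) a = 1 := by
  simp [dist_def, diffSet, smul_apply, hg]

instance : ContinuousConstSMul G (StepSpace G) :=
  ⟨fun g => (Isometry.of_dist_eq (dist_smul_smul g)).continuous⟩

/-- The set `[0, s)` for `s < 1`, and `[0, 1]` for `s = 1`. -/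
def initialSegment (s : I) : Set I := {x | x < s ∨ s = 1}

theorem measurableSet_initialSegment (s : I) : MeasurableSet (initialSegment s) :=
  measurableSet_Iio.union (MeasurableSet.const (s = 1))

/-- The function which is `1` on the initial segment of length `s` and `a` on the rest. -/
noncomputable def cut (s : I) (a : StepSpace G) : StepSpace G :=
  SimpleFunc.piecewise (initialSegment s) (measurableSet_initialSegment s)
    (SimpleFunc.const I 1) a

open Classical in
theorem cut_apply (s : I) (a : StepSpace G) (x : I) :
    SimpleFunc.toFun (cut s a) x = if x < s ∨ s = 1 then 1 else SimpleFunc.toFun a x := by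
  let b : SimpleFunc I G := a
  refine (congrFun (SimpleFunc.coe_piecewise (measurableSet_initialSegment s)
    (SimpleFunc.const I 1) b) x).trans ?_
  by_cases h : x < s ∨ s = 1
  · rw [if_pos h]
    exact Set.piecewise_eq_of_mem (initialSegment s) _ _ h
  · rw [if_neg h]
    exact Set.piecewise_eq_of_notMem (initialSegment s) _ _ h

theorem dist_cut (s t : I) (a b : StepSpace G) :
    dist (cut s a) (cut t b) ≤ dist s t + dist a b := by
  have h : diffSet (cut s a) (cut t b) ⊆ Set.uIcc s t ∪ diffSet a b := by
    intro x hx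
    by_contra hc
    simp only [Set.mem_union, not_or, Set.mem_uIcc, diffSet, Set.mem_ofPred_eq, not_not,
      not_and, not_le] at hc hx
    apply hx
    rw [cut_apply, cut_apply, hc.2]
    have h1 := x.2.2
    have key : (x < s ∨ s = 1) ↔ (x < t ∨ t = 1) := by
      constructor
      · rintro (h | rfl)
        · by_contra h'
          push Not at h'
          exact absurd (hc.1.2 h'.1) (not_lt.mpr h.le)
        · by_contra h'
          push Not at h'
          exact absurd (hc.1.2 h'.1) (not_lt.mpr h1)
      · rintro (h | rfl)
        · by_contra h'
          push Not at h'
          exact absurd (hc.1.1 h'.1) (not_lt.mpr h.le)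
        · by_contra h'
          push Not at h'
          exact absurd (hc.1.1 h'.1) (not_lt.mpr h1)
    simp only [key]
  have hv : volume.real (Set.uIcc s t) = dist s t := by
    rw [Measure.real, unitInterval.volume_uIcc, edist_dist, ENNReal.toReal_ofReal dist_nonneg,
      dist_comm]
  rw [← hv]
  exact (measureReal_mono h).trans (measureReal_union_le _ _)

theorem contractibleSpace : ContractibleSpace (StepSpace G) := by
  rw [contractible_iff_id_nullhomotopic]
  refine ⟨(SimpleFunc.const I 1 : SimpleFunc I G), ⟨⟨⟨fun z => cut z.1 z.2, ?_⟩, ?_, ?_⟩⟩⟩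
  · refine (LipschitzWith.of_dist_le_mul (K := 2) fun z w => ?_).continuous
    refine (dist_cut _ _ _ _).trans ?_
    have h1 : dist z.1 w.1 ≤ dist z w := le_max_left _ _
    have h2 : dist z.2 w.2 ≤ dist z w := le_max_right _ _
    push_cast
    linarith
  · intro a
    refine SimpleFunc.ext fun x => ?_
    refine (cut_apply 0 a x).trans ?_
    rw [if_neg (by simp)]
    rfl
  · intro a
    refine SimpleFunc.ext fun x => ?_
    refine (cut_apply 1 a x).trans ?_
    rw [if_pos (Or.inr rfl)]
    rfl

end StepSpace

/-- Every discrete group has a universal principal bundle. -/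
theorem isUniversalBundle_stepSpace (G : Type*) [Group G] :
    IsUniversalBundle G (StepSpace G) where
  contractible := StepSpace.contractibleSpace
  isPrincipalBundle :=
    { toIsQuotientMap := isQuotientMap_quotient_mk'
      toContinuousConstSMul := inferInstance
      apply_eq_iff_mem_orbit := Quotient.eq
      disjoint a := by
        refine ⟨Metric.ball a (1 / 2), Metric.ball_mem_nhds _ (by norm_num), fun g => ?_⟩
        rintro ⟨_, ⟨b, hb, rfl⟩, hgb⟩
        by_contra hg
        have h1 := StepSpace.dist_smul_self hg b
        have h2 := dist_triangle_right (g • b) b a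
        rw [Metric.mem_ball] at hb hgb
        change dist (g • b) a < 1 / 2 at hgb
        linarith }

end Existence

/-! ### The Borel construction -/

section Borel

variable (G : Type*) [Group G] (E : Type*) [TopologicalSpace E] [MulAction G E]

/-- The Borel construction `E ×_G X`: the quotient of `E × X` by the diagonal action. -/
abbrev BorelQuotient (X : Type*) [MulAction G X] : Type _ := OrbitSpace G (E × X)

/-- The map `E ×_G X → E ×_G Y`, `[e, x] ↦ [e, f x]`, induced by a `G`-equivariant map. -/
def borelMap {X Y : Type*} [TopologicalSpace X] [TopologicalSpace Y] [MulAction G X]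
    [MulAction G Y] (f : C(X, Y)) (hf : ∀ (g : G) (x : X), f (g • x) = g • f x) :
    C(BorelQuotient G E X, BorelQuotient G E Y) where
  toFun := Quotient.map (fun z => (z.1, f z.2)) (by
    rintro _ z ⟨g, rfl⟩
    exact ⟨g, Prod.ext rfl (hf g z.2).symm⟩)
  continuous_toFun := Continuous.quotient_map' (by fun_prop) _

end Borel

/-! ### Free loop spaces -/

/-- The free loop space `LX`: continuous maps `S¹ → X`, `S¹ = ℝ/ℤ`, with the compact-open
topology. -/
abbrev FreeLoopSpace (X : Type*) [TopologicalSpace X] : Type _ := C(UnitAddCircle, X)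

/-- The quotient map `[0, 1] → ℝ/ℤ`. -/
def intervalToCircle : C(I, UnitAddCircle) :=
  ⟨fun t => ((t : ℝ) : UnitAddCircle), by fun_prop⟩

theorem intervalToCircle_surjective : Function.Surjective intervalToCircle := by
  intro z
  obtain ⟨t, ht, rfl⟩ := (AddCircle.coe_image_Icc_eq (1 : ℝ) 0).ge (Set.mem_univ z)
  exact ⟨⟨t, by simpa using ht⟩, rfl⟩

/-- The loop `S¹ → X` defined by a path `[0, 1] → X` with equal end points. -/
noncomputable def closedPathToLoop {X : Type*} [TopologicalSpace X] (c : C(I, X))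
    (hc : c 0 = c 1) : FreeLoopSpace X where
  toFun := AddCircle.liftIco 1 0 (Set.IccExtend zero_le_one c)
  continuous_toFun := AddCircle.liftIco_zero_continuous
    (by simpa [Set.IccExtend_left, Set.IccExtend_right] using hc)
    (c.continuous.Icc_extend' (h := zero_le_one)).continuousOn

theorem closedPathToLoop_apply {X : Type*} [TopologicalSpace X] (c : C(I, X))
    (hc : c 0 = c 1) (t : I) : closedPathToLoop c hc (intervalToCircle t) = c t := by
  rcases lt_or_eq_of_le t.2.2 with h | h
  · have := AddCircle.liftIco_zero_coe_apply (p := (1 : ℝ)) (f := Set.IccExtend zero_le_one c)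
      (x := t) ⟨t.2.1, h⟩
    exact this.trans (Set.IccExtend_val zero_le_one c t)
  · have ht : t = 1 := Subtype.ext h
    have e : intervalToCircle t = intervalToCircle 0 := by
      subst ht
      change ((1 : ℝ) : UnitAddCircle) = ((0 : ℝ) : UnitAddCircle)
      simp
    rw [e, ht, ← hc]
    have := AddCircle.liftIco_zero_coe_apply (p := (1 : ℝ)) (f := Set.IccExtend zero_le_one c)
      (x := ((0 : I) : ℝ)) ⟨le_rfl, zero_lt_one⟩
    exact this.trans (Set.IccExtend_val zero_le_one c 0)

theorem continuous_closedPathToLoop {Z X : Type*} [TopologicalSpace Z] [TopologicalSpace X]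
    (c : Z → C(I, X)) (hc : ∀ z, c z 0 = c z 1) (hcont : Continuous c) :
    Continuous fun z => closedPathToLoop (c z) (hc z) := by
  refine ContinuousMap.continuous_of_continuous_uncurry _ ?_
  have hq : IsProperMap intervalToCircle := intervalToCircle.continuous.isProperMap
  have hp : IsProperMap (Prod.map (id : Z → Z) intervalToCircle) :=
    (Homeomorph.refl Z).isProperMap.prodMap hq
  have hquot : Topology.IsQuotientMap (Prod.map (id : Z → Z) intervalToCircle) :=
    hp.isClosedMap.isQuotientMap hp.continuous
      (Function.surjective_id.prodMap intervalToCircle_surjective)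
  rw [hquot.continuous_iff]
  have : (Function.uncurry fun z s => closedPathToLoop (c z) (hc z) s) ∘
      Prod.map (id : Z → Z) intervalToCircle = fun w : Z × I => c w.1 w.2 := by
    funext w
    exact closedPathToLoop_apply _ _ _
  rw [this]
  fun_prop

/-! ### The space of twisted paths -/

section Twisted

variable (G : Type*) [Group G] (M : Type*) [TopologicalSpace M] [MulAction G M]

/-- `𝒫_g(M) = {γ : [0, 1] → M | γ(1) = g γ(0)}`, a subspace of the path space `M^[0,1]` with the
compact-open topology. -/
def TwistedPath {G : Type*} [Group G] (M : Type*) [TopologicalSpace M] [MulAction G M] (g : G) :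
    Type _ := {c : C(I, M) // c 1 = g • c 0}

instance (g : G) : TopologicalSpace (TwistedPath M g) :=
  inferInstanceAs (TopologicalSpace {c : C(I, M) // c 1 = g • c 0})

/-- `𝒫_G(M) = ∐_{g ∈ G} 𝒫_g(M)`, with the topology of the disjoint union. -/
def TwistedPathSpace : Type _ := Σ g : G, TwistedPath M g

instance : TopologicalSpace (TwistedPathSpace G M) :=
  inferInstanceAs (TopologicalSpace (Σ g : G, TwistedPath M g))

namespace TwistedPathSpace

variable {G M}

/-- The path underlying a point of `𝒫_G(M)`. -/
def path (x : TwistedPathSpace G M) : C(I, M) := x.2.1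

theorem path_one (x : TwistedPathSpace G M) : x.path 1 = x.1 • x.path 0 := x.2.2

theorem ext {x y : TwistedPathSpace G M} (h₁ : x.1 = y.1) (h₂ : ∀ t, x.path t = y.path t) :
    x = y := by
  obtain ⟨g, c, hc⟩ := x
  obtain ⟨k, d, hd⟩ := y
  obtain rfl : g = k := h₁
  obtain rfl : c = d := ContinuousMap.ext h₂
  rfl

theorem orbitProj_path_zero (x : TwistedPathSpace G M) :
    (orbitProj G M).comp x.path 0 = (orbitProj G M).comp x.path 1 :=
  Quotient.sound ⟨x.1⁻¹, by simp [path_one]⟩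

theorem continuous_path : Continuous (path : TwistedPathSpace G M → C(I, M)) :=
  continuous_sigma fun _ => continuous_subtype_val

/-- The `G`-action on `𝒫_G(M)`: `h • (γ, g) = (h γ, h g h⁻¹)`. -/
instance [ContinuousConstSMul G M] : MulAction G (TwistedPathSpace G M) where
  smul h x := ⟨h * x.1 * h⁻¹, ⟨⟨fun t => h • x.path t, by fun_prop⟩, by
    change h • x.path 1 = (h * x.1 * h⁻¹) • h • x.path 0
    simp [path_one, mul_smul]⟩⟩
  one_smul x := ext (show 1 * x.1 * 1⁻¹ = x.1 by simp) fun t => one_smul G (x.path t)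
  mul_smul h k x := ext
    (show h * k * x.1 * (h * k)⁻¹ = h * (k * x.1 * k⁻¹) * h⁻¹ by simp [mul_assoc])
    fun t => mul_smul h k (x.path t)

@[simp] theorem smul_fst [ContinuousConstSMul G M] (h : G) (x : TwistedPathSpace G M) :
    (h • x).1 = h * x.1 * h⁻¹ := rfl

@[simp] theorem smul_path [ContinuousConstSMul G M] (h : G) (x : TwistedPathSpace G M) (t : I) :
    (h • x).path t = h • x.path t := rfl

/-- The map `𝒫_G(M) → 𝒫_G(N)`, `(γ, g) ↦ (f ∘ γ, g)`, induced by a `G`-equivariant map. -/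
def map {N : Type*} [TopologicalSpace N] [MulAction G N] (f : C(M, N))
    (hf : ∀ (g : G) (x : M), f (g • x) = g • f x) :
    C(TwistedPathSpace G M, TwistedPathSpace G N) where
  toFun x := ⟨x.1, ⟨f.comp x.path, by
    change f (x.path 1) = x.1 • f (x.path 0)
    rw [path_one, hf]⟩⟩
  continuous_toFun := continuous_sigma fun g => continuous_sigmaMk.comp
    (Continuous.subtype_mk (p := fun c : C(I, N) => c 1 = g • c 0)
      ((ContinuousMap.continuous_postcomp f).comp continuous_subtype_val) _)

/-- The map `p̃ : 𝒫_G(M) → L(M/G)` sending `(γ, g)` to the loop `p ∘ γ`. -/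
noncomputable def toLoop : C(TwistedPathSpace G M, FreeLoopSpace (OrbitSpace G M)) where
  toFun x := closedPathToLoop ((orbitProj G M).comp x.path) x.orbitProj_path_zero
  continuous_toFun := continuous_closedPathToLoop _ orbitProj_path_zero
    ((ContinuousMap.continuous_postcomp (orbitProj G M)).comp continuous_path)

theorem toLoop_apply (x : TwistedPathSpace G M) (t : I) :
    toLoop x (intervalToCircle t) = orbitProj G M (x.path t) :=
  closedPathToLoop_apply _ x.orbitProj_path_zero t

theorem toLoop_smul [ContinuousConstSMul G M] (g : G) (x : TwistedPathSpace G M) :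
    toLoop (g • x) = toLoop x := by
  ext s
  obtain ⟨t, rfl⟩ := intervalToCircle_surjective s
  rw [toLoop_apply, toLoop_apply]
  exact Quotient.sound ⟨g, rfl⟩

end TwistedPathSpace

end Twisted

/-! ### The comparison maps -/

section Comparison

variable (G : Type*) [Group G] (E : Type*) [TopologicalSpace E] [MulAction G E]
  (M : Type*) [TopologicalSpace M] [MulAction G M] [ContinuousConstSMul G M]

/-- The map `p̄ : E ×_G 𝒫_G(M) → L(M/G)`, `[e, (γ, g)] ↦ p ∘ γ`, induced by the projection
`p : M → M/G`. -/
noncomputable def borelToLoop :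
    C(BorelQuotient G E (TwistedPathSpace G M), FreeLoopSpace (OrbitSpace G M)) where
  toFun := Quotient.lift (fun z => TwistedPathSpace.toLoop z.2) (by
    rintro _ z ⟨g, rfl⟩
    exact TwistedPathSpace.toLoop_smul g z.2)
  continuous_toFun := Continuous.quotient_lift (by fun_prop) _

/-- The map `E ×_G 𝒫_G(E × M) → E ×_G 𝒫_G(M)` induced by the second projection
`p₂ : E × M → M`. -/
def borelTwistedSnd [ContinuousConstSMul G E] :
    C(BorelQuotient G E (TwistedPathSpace G (E × M)), BorelQuotient G E (TwistedPathSpace G M)) :=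
  borelMap G E (TwistedPathSpace.map ContinuousMap.snd fun _ _ => rfl) fun _ _ => rfl

end Comparison

/-! ### Lifting cubes relative to their boundary -/

/-! All the maps in question are acyclic Serre fibrations in the strict sense of `CubeLifting`: a
cube in the target lifts, extending any given lift of its boundary. Such a map is a weak
equivalence, because lifting cubes gives surjectivity on homotopy groups and lifting prisms gives
injectivity.

Two sources of lifting are combined. A contractible `E` supplies extensions from the boundary of a
cube, so `E × P → P` has the property (`CubeLifting.snd`), and so does `𝒫_G(E × M) → 𝒫_G(M)`
(`cubeLifting_snd`). Covering theory supplies lifts of whole cubes, without boundary condition,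
through a quotient by a free action.

The descent lemma `HasWanderingNhds.cubeLifting` joins them. Let `F : X → Y` be equivariant with
cube lifting, and let `π : Y → Z` have the `G`-orbits as fibres. Lift a cube of `Z` to `Y`. Since
the action on `Y` is free with wandering neighbourhoods, boundary data in `X/G` has a unique
continuous lift to `X` over that cube. Extend it by the property of `F` and project to `X/G`.

For `p̄` take `Y = 𝒫_G(M)` and `Z = L(M/G)`: a cube of loops lifts to a cube of paths in the cover
`M`, whose end points differ by a locally constant, hence constant, group element. For the map
induced by `p₂` take `Y = E × 𝒫_G(M)` and `Z = Y/G`. Finally `E × M` is principal because `E` is. -/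

/-- A surjective map with the strict right lifting property against the inclusions of the
boundaries of all cubes. -/
structure CubeLifting {X Y : Type*} [TopologicalSpace X] [TopologicalSpace Y] (f : C(X, Y)) :
    Prop where
  -- The case `n = 0` of the next field does not give this when `X` is empty, since it starts from a
  -- total function `a`.
  surjective : Function.Surjective f
  exists_lift : ∀ (n : ℕ) (a : (Fin n → I) → X) (b : C(Fin n → I, Y)),
    ContinuousOn a (Cube.boundary (Fin n)) → (∀ x ∈ Cube.boundary (Fin n), f (a x) = b x) →
    ∃ c : C(Fin n → I, X), (∀ x ∈ Cube.boundary (Fin n), c x = a x) ∧ ∀ x, f (c x) = b x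

theorem Cube.isClosed_boundary (n : ℕ) : IsClosed (Cube.boundary (Fin n)) := by
  have : Cube.boundary (Fin n) = ⋃ i : Fin n, {y | y i = 0} ∪ {y | y i = 1} := by
    ext y
    simp [Cube.boundary]
  rw [this]
  exact isClosed_iUnion_of_finite fun i =>
    (isClosed_eq (continuous_apply i) continuous_const).union
      (isClosed_eq (continuous_apply i) continuous_const)

/-- The boundary of the prism `[0, 1] × [0, 1]ⁿ`. -/
def prismBoundary (n : ℕ) : Set (I × (Fin n → I)) :=
  {z | (z.1 = 0 ∨ z.1 = 1) ∨ z.2 ∈ Cube.boundary (Fin n)}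

theorem prismBoundary_eq (n : ℕ) : prismBoundary n =
    ({z | z.1 = 0} ∪ {z | z.1 = 1}) ∪ {z | z.2 ∈ Cube.boundary (Fin n)} := rfl

/-- The two ends and the side are closed, so continuity can be checked on each piece separately. -/
theorem continuousOn_prismBoundary {X : Type*} [TopologicalSpace X] {n : ℕ}
    {a : I × (Fin n → I) → X} (h0 : Continuous fun x => a (0, x))
    (h1 : Continuous fun x => a (1, x))
    (hb : ContinuousOn a {z | z.2 ∈ Cube.boundary (Fin n)}) :
    ContinuousOn a (prismBoundary n) := by
  have c0 : IsClosed {z : I × (Fin n → I) | z.1 = 0} := isClosed_eq continuous_fst continuous_const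
  have c1 : IsClosed {z : I × (Fin n → I) | z.1 = 1} := isClosed_eq continuous_fst continuous_const
  have cb : IsClosed {z : I × (Fin n → I) | z.2 ∈ Cube.boundary (Fin n)} :=
    (Cube.isClosed_boundary n).preimage continuous_snd
  rw [prismBoundary_eq]
  refine ((ContinuousOn.union_of_isClosed ?_ ?_ c0 c1).union_of_isClosed hb (c0.union c1) cb)
  · refine (h0.comp continuous_snd).continuousOn.congr ?_
    rintro ⟨t, x⟩ (rfl : t = 0)
    rfl
  · refine (h1.comp continuous_snd).continuousOn.congr ?_
    rintro ⟨t, x⟩ (rfl : t = 1)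
    rfl

namespace CubeLifting

variable {X Y : Type*} [TopologicalSpace X] [TopologicalSpace Y] {f : C(X, Y)}

/-- The prism is the cube of dimension `n + 1`, with its interval factor as coordinate `0`. -/
theorem exists_lift_prism (hf : CubeLifting f) (n : ℕ) (a : I × (Fin n → I) → X)
    (b : C(I × (Fin n → I), Y)) (ha : ContinuousOn a (prismBoundary n))
    (hab : ∀ z ∈ prismBoundary n, f (a z) = b z) :
    ∃ c : C(I × (Fin n → I), X), (∀ z ∈ prismBoundary n, c z = a z) ∧ ∀ z, f (c z) = b z := by
  let φ : C(Fin (n + 1) → I, I × (Fin n → I)) := ⟨fun y => (y 0, fun i => y i.succ), by fun_prop⟩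
  let ψ : C(I × (Fin n → I), Fin (n + 1) → I) :=
    ⟨fun z => Fin.cons z.1 z.2, Continuous.finCons continuous_fst continuous_snd⟩
  have hφψ (z) : φ (ψ z) = z := by simp [φ, ψ]
  have hφ : ∀ y ∈ Cube.boundary (Fin (n + 1)), φ y ∈ prismBoundary n := by
    rintro y ⟨i, hi⟩
    refine Fin.cases (fun hi => Or.inl hi) (fun j hi => Or.inr ⟨j, hi⟩) i hi
  have hψ : ∀ z ∈ prismBoundary n, ψ z ∈ Cube.boundary (Fin (n + 1)) := by
    rintro z (h | ⟨j, hj⟩)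
    · exact ⟨0, h⟩
    · exact ⟨j.succ, hj⟩
  obtain ⟨c, hc, hfc⟩ := hf.exists_lift (n + 1) (a ∘ φ) (b.comp φ)
    (ha.comp φ.continuous.continuousOn hφ) fun y hy => hab _ (hφ y hy)
  refine ⟨c.comp ψ, fun z hz => ?_, fun z => ?_⟩
  · simpa [hφψ] using hc _ (hψ z hz)
  · simpa [hφψ] using hfc (ψ z)

/-- Homotopies relative to the boundary of the cube lift. -/
theorem homotopicRel (hf : CubeLifting f) {n : ℕ} {p q : C(Fin n → I, X)}
    (hpq : ∀ x ∈ Cube.boundary (Fin n), p x = q x)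
    (h : (f.comp p).HomotopicRel (f.comp q) (Cube.boundary (Fin n))) :
    p.HomotopicRel q (Cube.boundary (Fin n)) := by
  classical
  obtain ⟨H⟩ := h
  -- Only the values on the prism boundary matter: `p` at the bottom, `q` at the top, and their
  -- common value on the side.
  let a : I × (Fin n → I) → X := fun z => if z.1 = 1 then q z.2 else p z.2
  have ab : ∀ z : I × (Fin n → I), z.2 ∈ Cube.boundary (Fin n) → a z = p z.2 := by
    intro z hz
    by_cases h1 : z.1 = 1
    · simp only [a, if_pos h1, hpq _ hz]
    · simp only [a, if_neg h1]
  have a0 (x) : a (0, x) = p x := by simp [a]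
  have a1 (x) : a (1, x) = q x := by simp [a]
  have ha : ContinuousOn a (prismBoundary n) := by
    refine continuousOn_prismBoundary ?_ ?_ ?_
    · simpa only [a0] using p.continuous
    · simpa only [a1] using q.continuous
    · exact (p.continuous.comp continuous_snd).continuousOn.congr ab
  obtain ⟨c, hc, -⟩ := hf.exists_lift_prism n a H.toContinuousMap ha (by
    rintro ⟨t, x⟩ ((ht | ht) | hx)
    · obtain rfl : t = 0 := ht
      rw [a0]
      exact (H.map_zero_left x).symm
    · obtain rfl : t = 1 := ht
      rw [a1]
      exact (H.map_one_left x).symm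
    · rw [ab (t, x) hx]
      exact (H.prop' t x hx).symm)
  exact ⟨{ toContinuousMap := c
           map_zero_left x := (hc _ (.inl (.inl rfl))).trans (a0 x)
           map_one_left x := (hc _ (.inl (.inr rfl))).trans (a1 x)
           prop' t x hx := (hc (t, x) (.inr hx)).trans (ab (t, x) hx) }⟩

/-- Injectivity comes from lifting homotopies relative to the boundary, surjectivity on homotopy
groups from lifting a cube with constant boundary data. For path components, a path is a homotopy of
`0`-cubes. -/
theorem isWeakHomotopyEquiv (hf : CubeLifting f) : IsWeakHomotopyEquiv f where
  bijective_pathComponents := by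
    refine ⟨?_, ?_⟩
    · rintro ⟨x⟩ ⟨y⟩ h
      obtain ⟨γ⟩ : Joined (f x) (f y) := Quotient.exact h
      obtain ⟨H⟩ := hf.homotopicRel (n := 0) (p := .const _ x) (q := .const _ y)
        (by rintro _ ⟨i, -⟩; exact i.elim0)
        ⟨{ toFun z := γ z.1
           map_zero_left _ := γ.source
           map_one_left _ := γ.target
           prop' := by rintro _ _ ⟨i, -⟩; exact i.elim0 }⟩
      refine Quotient.sound ⟨⟨⟨fun t => H (t, 0), by fun_prop⟩, ?_, ?_⟩⟩
      · exact H.map_zero_left 0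
      · exact H.map_one_left 0
    · rintro ⟨y⟩
      obtain ⟨x, rfl⟩ := hf.surjective y
      exact ⟨Quotient.mk _ x, rfl⟩
  bijective_homotopyGroup n _ x := by
    refine ⟨?_, ?_⟩
    · rintro ⟨p⟩ ⟨q⟩ h
      have h' : GenLoop.Homotopic (genLoopMap f n x p) (genLoopMap f n x q) := Quotient.exact h
      exact Quotient.sound (hf.homotopicRel (p := p.1) (q := q.1)
        (fun y hy => (p.2 y hy).trans (q.2 y hy).symm) h')
    · rintro ⟨b⟩
      obtain ⟨c, hc, hfc⟩ := hf.exists_lift n (fun _ => x) b.1 continuousOn_const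
        fun y hy => (b.2 y hy).symm
      exact ⟨Quotient.mk _ ⟨c, hc⟩, congrArg (Quotient.mk _) (Subtype.ext (ContinuousMap.ext hfc))⟩

end CubeLifting

/-! ### Extending maps into contractible spaces -/

/-- Twice the sup-distance from the center of the cube. -/
def Cube.radius {n : ℕ} (x : Fin n → I) : ℝ := ‖fun i => 2 * (x i : ℝ) - 1‖

theorem Cube.continuous_radius {n : ℕ} : Continuous (Cube.radius : (Fin n → I) → ℝ) := by
  unfold Cube.radius
  fun_prop

theorem Cube.radius_of_mem_boundary {n : ℕ} {x : Fin n → I} (hx : x ∈ Cube.boundary (Fin n)) :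
    Cube.radius x = 1 := by
  refine le_antisymm ((pi_norm_le_iff_of_nonneg zero_le_one).2 fun i => ?_) ?_
  · rw [Real.norm_eq_abs, abs_le]
    constructor <;> linarith [(x i).2.1, (x i).2.2]
  · obtain ⟨i, hi⟩ := hx
    refine le_trans ?_ (norm_le_pi_norm _ i)
    rcases hi with hi | hi <;> norm_num [hi]

/-- The radial projection of the cube minus its center to the boundary, extended by a different
formula near the center. -/
noncomputable def Cube.radialProj {n : ℕ} (x : Fin n → I) : Fin n → I := fun i =>
  Set.projIcc 0 1 zero_le_one (((2 * (x i : ℝ) - 1) / max (Cube.radius x) (1 / 2) + 1) / 2)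

theorem Cube.continuous_radialProj {n : ℕ} :
    Continuous (Cube.radialProj : (Fin n → I) → (Fin n → I)) := by
  refine continuous_pi fun i => continuous_projIcc.comp ?_
  have h : ∀ x : Fin n → I, max (Cube.radius x) (1 / 2) ≠ 0 := fun x =>
    (lt_max_of_lt_right (by norm_num)).ne'
  have := Cube.continuous_radius (n := n)
  fun_prop (disch := assumption)

theorem Cube.radialProj_mem_boundary {n : ℕ} {x : Fin n → I} (hx : 1 / 2 ≤ Cube.radius x) :
    Cube.radialProj x ∈ Cube.boundary (Fin n) := by
  have hpos : 0 < Cube.radius x := by linarith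
  -- A coordinate attaining the sup norm is pushed to `0` or `1`.
  obtain ⟨i, hi⟩ : ∃ i, Cube.radius x ≤ ‖2 * (x i : ℝ) - 1‖ := by
    by_contra! h
    exact lt_irrefl _ ((pi_norm_lt_iff hpos).2 h)
  have hi' : |2 * (x i : ℝ) - 1| = Cube.radius x := 
    le_antisymm (norm_le_pi_norm (fun i => 2 * (x i : ℝ) - 1) i) hi
  refine ⟨i, ?_⟩
  rw [Cube.radialProj, max_eq_left hx]
  rcases abs_choice (2 * (x i : ℝ) - 1) with h | h
  · right
    rw [← h, hi', div_self hpos.ne']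
    exact Set.projIcc_of_right_le _ (by norm_num)
  · left
    rw [← neg_neg (2 * (x i : ℝ) - 1), ← h, hi', neg_div, div_self hpos.ne']
    exact Set.projIcc_of_le_left _ (by norm_num)

theorem Cube.radialProj_of_mem_boundary {n : ℕ} {x : Fin n → I}
    (hx : x ∈ Cube.boundary (Fin n)) : Cube.radialProj x = x := by
  funext i
  have : ((2 * (x i : ℝ) - 1) / max (Cube.radius x) (1 / 2) + 1) / 2 = x i := by
    rw [Cube.radius_of_mem_boundary hx, max_eq_left (by norm_num)]
    ring
  rw [Cube.radialProj, this]
  exact Set.projIcc_val _ _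

/-- Maps from the boundary of a cube to a contractible space extend to the cube. -/
theorem exists_extension_of_contractible {E : Type*} [TopologicalSpace E] [ContractibleSpace E]
    {n : ℕ} (u : (Fin n → I) → E) (hu : ContinuousOn u (Cube.boundary (Fin n))) :
    ∃ U : C(Fin n → I, E), ∀ x ∈ Cube.boundary (Fin n), U x = u x := by
  classical
  obtain ⟨e, ⟨H⟩⟩ := id_nullhomotopic E
  -- As the radius falls from `1` to `1 / 2`, the time of the contraction `H` runs from `0` to `1`.
  -- The boundary values are thus contracted to `e`, which fills the inner cube.
  let U : (Fin n → I) → E := fun x => if Cube.radius x ≤ 1 / 2 then e else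
    H (Set.projIcc 0 1 zero_le_one (2 - 2 * Cube.radius x), u (Cube.radialProj x))
  have hr := Cube.continuous_radius (n := n)
  have hU : Continuous U := by
    rw [← continuousOn_univ]
    have : (Set.univ : Set (Fin n → I)) = {x | Cube.radius x ≤ 1 / 2} ∪ {x | 1 / 2 ≤ Cube.radius x} :=
      (Set.eq_univ_of_forall fun x => le_total (Cube.radius x) (1 / 2)).symm
    rw [this]
    refine ContinuousOn.union_of_isClosed ?_ ?_ (isClosed_le hr continuous_const)
      (isClosed_le continuous_const hr)
    · exact continuousOn_const.congr fun x hx => if_pos hx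
    · refine ContinuousOn.congr (f := fun x =>
        H (Set.projIcc 0 1 zero_le_one (2 - 2 * Cube.radius x), u (Cube.radialProj x))) ?_ ?_
      · refine H.continuous.comp_continuousOn (ContinuousOn.prodMk ?_ ?_)
        · exact (continuous_projIcc.comp (by fun_prop)).continuousOn
        · exact hu.comp Cube.continuous_radialProj.continuousOn fun x hx =>
            Cube.radialProj_mem_boundary hx
      · intro x hx
        by_cases h : Cube.radius x ≤ 1 / 2
        · have h' : Cube.radius x = 1 / 2 := le_antisymm h hx
          have h1 : Set.projIcc (0 : ℝ) 1 zero_le_one (2 - 2 * Cube.radius x) = 1 :=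
            Set.projIcc_of_right_le _ (by rw [h']; norm_num)
          simp only [U, if_pos h, h1]
          exact (H.map_one_left _).symm
        · exact if_neg h
  refine ⟨⟨U, hU⟩, fun x hx => ?_⟩
  have h1 := Cube.radius_of_mem_boundary hx
  have h2 : Set.projIcc (0 : ℝ) 1 zero_le_one (2 - 2 * Cube.radius x) = 0 :=
    Set.projIcc_of_le_left _ (by rw [h1]; norm_num)
  have h3 : ¬ Cube.radius x ≤ 1 / 2 := by rw [h1]; norm_num
  change U x = u x
  simp only [U, if_neg h3, h2, Cube.radialProj_of_mem_boundary hx]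
  exact H.map_zero_left _

/-- The `P`-component of the lift is forced; the `E`-component is an extension problem into a
contractible space. -/
theorem CubeLifting.snd {E : Type*} [TopologicalSpace E] [ContractibleSpace E] (P : Type*)
    [TopologicalSpace P] : CubeLifting (ContinuousMap.snd : C(E × P, P)) where
  surjective := Prod.snd_surjective
  exists_lift n a b ha hab := by
    obtain ⟨U, hU⟩ := exists_extension_of_contractible (fun x => (a x).1) ha.fst
    exact ⟨U.prodMk b, fun x hx => Prod.ext (hU x hx) (hab x hx).symm, fun x => rfl⟩

/-- Maps from the boundary of a prism to a contractible space extend to the prism. -/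
theorem exists_extension_prism {E : Type*} [TopologicalSpace E] [ContractibleSpace E]
    {n : ℕ} (u : I × (Fin n → I) → E) (hu : ContinuousOn u (prismBoundary n)) :
    ∃ U : C(I × (Fin n → I), E), ∀ x ∈ prismBoundary n, U x = u x := by
  -- With a one-point base, lifting is the same as extending.
  obtain ⟨c, hc, -⟩ := (CubeLifting.snd (E := E) Unit).exists_lift_prism n (fun z => (u z, ()))
    (.const _ ()) (hu.prodMk continuousOn_const) fun _ _ => rfl
  exact ⟨ContinuousMap.fst.comp c, fun x hx => congrArg Prod.fst (hc x hx)⟩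

/-! ### Lifting cubes through covering maps -/

/-- Lift `b ∘ r` on the simply connected space `V`, then restrict along the section `s`. Cubes and
prisms are retracts of Euclidean spaces by clamping each coordinate. -/
theorem IsCoveringMap.exists_lift_of_retract {X Y V Z : Type*} [TopologicalSpace X]
    [TopologicalSpace Y] [TopologicalSpace V] [TopologicalSpace Z] [SimplyConnectedSpace V]
    [LocallyPathConnectedSpace V] {p : X → Y} (hp : IsCoveringMap p)
    (hs : Function.Surjective p) {r : C(V, Z)} {s : C(Z, V)} (hrs : ∀ z, r (s z) = z)
    (b : C(Z, Y)) : ∃ c : C(Z, X), ∀ z, p (c z) = b z := by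
  obtain ⟨v⟩ : Nonempty V := inferInstance
  obtain ⟨x, hx⟩ := hs (b (r v))
  obtain ⟨F, ⟨-, hF⟩, -⟩ := hp.existsUnique_continuousMap_lifts (b.comp r) v x hx
  exact ⟨F.comp s, fun z => (congrFun hF (s z)).trans (congrArg b (hrs z))⟩

theorem IsCoveringMap.exists_lift_cube {X Y : Type*} [TopologicalSpace X] [TopologicalSpace Y]
    {p : X → Y} (hp : IsCoveringMap p) (hs : Function.Surjective p) {n : ℕ}
    (b : C(Fin n → I, Y)) : ∃ c : C(Fin n → I, X), ∀ z, p (c z) = b z :=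
  hp.exists_lift_of_retract hs (V := Fin n → ℝ)
    (r := (⟨fun v i => Set.projIcc 0 1 zero_le_one (v i),
      continuous_pi fun i => continuous_projIcc.comp (continuous_apply i)⟩ :
        C(Fin n → ℝ, Fin n → I)))
    (s := ⟨fun x i => x i, by fun_prop⟩)
    (fun x => funext fun i => Set.projIcc_val zero_le_one (x i)) b

theorem IsCoveringMap.exists_lift_prism {X Y : Type*} [TopologicalSpace X] [TopologicalSpace Y]
    {p : X → Y} (hp : IsCoveringMap p) (hs : Function.Surjective p) {n : ℕ}
    (b : C((Fin n → I) × I, Y)) : ∃ c : C((Fin n → I) × I, X), ∀ z, p (c z) = b z :=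
  hp.exists_lift_of_retract hs (V := (Fin n → ℝ) × ℝ)
    (r := (⟨fun v => (fun i => Set.projIcc 0 1 zero_le_one (v.1 i),
        Set.projIcc 0 1 zero_le_one v.2),
      (continuous_pi fun i => continuous_projIcc.comp (by fun_prop)).prodMk
        (continuous_projIcc.comp continuous_snd)⟩ : C((Fin n → ℝ) × ℝ, (Fin n → I) × I)))
    (s := ⟨fun x => (fun i => x.1 i, x.2), by fun_prop⟩)
    (fun x => Prod.ext (funext fun i => Set.projIcc_val zero_le_one (x.1 i))
      (Set.projIcc_val zero_le_one x.2)) b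

/-! ### Orbit spaces of equivariant maps -/

/-- Every point has a neighbourhood which is disjoint from its translates. -/
def HasWanderingNhds (G : Type*) [Group G] (X : Type*) [TopologicalSpace X] [MulAction G X] :
    Prop :=
  ∀ x : X, ∃ U ∈ 𝓝 x, ∀ g : G, ((g • ·) '' U ∩ U).Nonempty → g = 1

namespace HasWanderingNhds

variable {G : Type*} [Group G] {X Y : Type*} [TopologicalSpace X] [MulAction G X]
  [TopologicalSpace Y] [MulAction G Y]

theorem of_equivariant (hY : HasWanderingNhds G Y) (f : C(X, Y))
    (hf : ∀ (g : G) (x : X), f (g • x) = g • f x) : HasWanderingNhds G X := by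
  intro x
  obtain ⟨U, hU, hgU⟩ := hY (f x)
  refine ⟨f ⁻¹' U, f.continuous.continuousAt.preimage_mem_nhds hU, fun g => ?_⟩
  rintro ⟨_, ⟨y, hy, rfl⟩, hgy⟩
  exact hgU g ⟨_, ⟨f y, hy, (hf g y).symm⟩, hgy⟩

theorem isPrincipalBundle [ContinuousConstSMul G X] (hX : HasWanderingNhds G X) :
    IsPrincipalBundle G X where
  toIsQuotientMap := isQuotientMap_quotient_mk'
  toContinuousConstSMul := inferInstance
  apply_eq_iff_mem_orbit := Quotient.eq
  disjoint := hX

/-- An equivariant map with the cube lifting property induces a map with this property from its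
orbit space to any space with lifts of cubes to the total space of an action with wandering
neighbourhoods. -/
theorem cubeLifting [ContinuousConstSMul G X] (hY : HasWanderingNhds G Y) {F : C(X, Y)}
    (hF : CubeLifting F) (hFG : ∀ (g : G) (x : X), F (g • x) = g • F x) {Z : Type*}
    [TopologicalSpace Z] {π : Y → Z} (hπ : ∀ y y', π y = π y' ↔ y ∈ MulAction.orbit G y')
    (hlift : ∀ (n : ℕ) (b : C(Fin n → I, Z)), ∃ c : C(Fin n → I, Y), ∀ x, π (c x) = b x)
    {f : C(OrbitSpace G X, Z)} (hf : ∀ x, f (orbitProj G X x) = π (F x)) : CubeLifting f where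
  surjective z := by
    obtain ⟨c, hc⟩ := hlift 0 (.const _ z)
    obtain ⟨x, hx⟩ := hF.surjective (c 0)
    exact ⟨orbitProj G X x, by rw [hf, hx, hc]; rfl⟩
  exists_lift n a b ha hab := by
    obtain ⟨c, hc⟩ := hlift n b
    -- On the boundary, `w x` is the point of the orbit `a x` lying over `c x`; elsewhere it is an
    -- arbitrary value.
    have key : ∀ x, ∃ w : X, x ∈ Cube.boundary (Fin n) → orbitProj G X w = a x ∧ F w = c x := by
      intro x
      obtain ⟨w, hw⟩ : ∃ w, orbitProj G X w = a x := Quotient.mk_surjective (a x)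
      by_cases hx : x ∈ Cube.boundary (Fin n)
      · obtain ⟨g, hg⟩ := (hπ (c x) (F w)).1 (by rw [hc, ← hf, hw, hab x hx])
        have hgw : orbitProj G X (g • w) = orbitProj G X w :=
          Quotient.sound (MulAction.mem_orbit w g)
        exact ⟨g • w, fun _ => ⟨hgw.trans hw, (hFG g w).trans hg⟩⟩
      · exact ⟨w, fun h => absurd h hx⟩
    choose w hw using key
    have hwc : ContinuousOn w (Cube.boundary (Fin n)) := by
      intro x hx
      rw [ContinuousWithinAt, tendsto_nhds]
      intro W hW hxW
      obtain ⟨U, hU, hgU⟩ := hY (c x)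
      obtain ⟨U', hU', hUo, hxU⟩ := mem_nhds_iff.1 hU
      have hopen : IsOpenMap (orbitProj G X) := isOpenMap_quotient_mk'_mul
      -- Orbit projections are open, so for `y` near `x` the orbit `a y` meets `W ∩ F ⁻¹' U'` in
      -- some `v = g • w y`.
      have hmem : orbitProj G X '' (W ∩ F ⁻¹' U') ∈ 𝓝 (a x) := by
        refine (hopen _ (hW.inter (hUo.preimage F.continuous))).mem_nhds ⟨w x, ⟨hxW, ?_⟩,
          (hw x hx).1⟩
        rw [Set.mem_preimage, (hw x hx).2]
        exact hxU
      filter_upwards [ha x hx hmem, self_mem_nhdsWithin, mem_nhdsWithin_of_mem_nhds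
        (c.continuous.continuousAt.preimage_mem_nhds (hUo.mem_nhds hxU))] with y hy hyb hyU
      obtain ⟨v, ⟨hvW, hvU⟩, hv⟩ := hy
      obtain ⟨g, hg⟩ : v ∈ MulAction.orbit G (w y) :=
        Quotient.exact (hv.trans (hw y hyb).1.symm)
      have hg' : g • w y = v := hg
      -- Both `c y` and `g • c y = F v` lie in the wandering neighbourhood, which forces `g = 1` and
      -- so `w y = v ∈ W`.
      have : g = 1 := by
        refine hgU g ⟨_, ⟨c y, hU' hyU, rfl⟩, ?_⟩
        have : g • c y = F v := by rw [← (hw y hyb).2, ← hFG, hg']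
        change g • c y ∈ U
        rw [this]
        exact hU' hvU
      rw [this, one_smul] at hg'
      exact Set.mem_preimage.2 (hg'.symm ▸ hvW)
    obtain ⟨d, hd, hFd⟩ := hF.exists_lift n w c hwc fun x hx => (hw x hx).2
    refine ⟨(orbitProj G X).comp d, fun x hx => ?_, fun x => ?_⟩
    · rw [ContinuousMap.comp_apply, hd x hx]
      exact (hw x hx).1
    · rw [ContinuousMap.comp_apply, hf, hFd, hc]

end HasWanderingNhds

/-! ### Twisted paths -/

namespace TwistedPathSpace

variable {G : Type*} [Group G] {M : Type*} [TopologicalSpace M] [MulAction G M]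

instance [ContinuousConstSMul G M] : ContinuousConstSMul G (TwistedPathSpace G M) where
  continuous_const_smul h := continuous_sigma fun g =>
    (continuous_sigmaMk : Continuous
      (Sigma.mk (h * g * h⁻¹) : _ → Σ g : G, TwistedPath M g)).comp
    (Continuous.subtype_mk (p := fun c : C(I, M) => c 1 = (h * g * h⁻¹) • c 0)
      (f := fun c : TwistedPath M g => (⟨fun t => h • c.1 t, by fun_prop⟩ : C(I, M)))
      ((ContinuousMap.continuous_postcomp ⟨fun m : M => h • m, by fun_prop⟩).comp
        continuous_subtype_val) _)

theorem continuous_fst [TopologicalSpace G] [DiscreteTopology G] :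
    Continuous fun x : TwistedPathSpace G M => x.1 :=
  continuous_sigma fun _ => continuous_const

/-- A family of twisted paths with the same group element, given by a map of two variables. -/
def ofUncurry {Z : Type*} [TopologicalSpace Z] (g : G) (c : C(Z × I, M))
    (hc : ∀ z, c (z, 1) = g • c (z, 0)) : C(Z, TwistedPathSpace G M) where
  toFun z := ⟨g, ⟨c.curry z, hc z⟩⟩
  continuous_toFun := (continuous_sigmaMk : Continuous
      (Sigma.mk g : _ → Σ g : G, TwistedPath M g)).comp
    (Continuous.subtype_mk (p := fun c : C(I, M) => c 1 = g • c 0) c.curry.continuous _)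

/-- Evaluation of twisted paths at `t`. -/
def eval (t : I) : C(TwistedPathSpace G M, M) :=
  ⟨fun x => x.path t, (continuous_eval_const t).comp continuous_path⟩

theorem continuous_eval_uncurry :
    Continuous fun z : TwistedPathSpace G M × I => z.1.path z.2 := by
  have := continuous_path (G := G) (M := M)
  fun_prop

theorem hasWanderingNhds [ContinuousConstSMul G M] (hM : HasWanderingNhds G M) :
    HasWanderingNhds G (TwistedPathSpace G M) :=
  hM.of_equivariant (eval 0) fun _ _ => rfl

/-- Translate `y` so that the starting points agree. Uniqueness of path lifting in the covering `M →
M/G` then identifies the paths, and freeness of the action identifies the group elements. -/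
theorem toLoop_eq_iff [ContinuousConstSMul G M] (hM : IsPrincipalBundle G M)
    (x y : TwistedPathSpace G M) : toLoop x = toLoop y ↔ x ∈ MulAction.orbit G y := by
  refine ⟨fun h => ?_, ?_⟩
  · have hp (t : I) : orbitProj G M (x.path t) = orbitProj G M (y.path t) := by
      rw [← toLoop_apply, ← toLoop_apply, h]
    obtain ⟨g, hg⟩ := hM.apply_eq_iff_mem_orbit.1 (hp 0)
    have hg : g • y.path 0 = x.path 0 := hg
    have hpath : (x.path : I → M) = (g • y).path :=
      hM.isCoveringMap.eq_of_comp_eq x.path.continuous (g • y).path.continuous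
        (funext fun t => (hp t).trans (Quotient.sound ⟨g⁻¹, inv_smul_smul g (y.path t)⟩))
        0 hg.symm
    refine ⟨g, (ext ?_ fun t => congrFun hpath t).symm⟩
    have := hM.isCancelSMul
    refine IsCancelSMul.right_cancel x.1 (g • y).1 (x.path 0) ?_
    rw [← path_one, congrFun hpath 1, congrFun hpath 0, path_one]
  · rintro ⟨g, rfl⟩
    exact toLoop_smul g y

/-- Cubes in the free loop space of the base of a principal bundle lift to twisted paths. -/
theorem exists_lift_toLoop [ContinuousConstSMul G M] (hM : IsPrincipalBundle G M) (n : ℕ)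
    (b : C(Fin n → I, FreeLoopSpace (OrbitSpace G M))) :
    ∃ c : C(Fin n → I, TwistedPathSpace G M), ∀ x, toLoop (c x) = b x := by
  obtain ⟨B, hB⟩ := hM.isCoveringMap.exists_lift_prism hM.surjective
    (⟨fun z => b z.1 (intervalToCircle z.2), by fun_prop⟩ : C((Fin n → I) × I, OrbitSpace G M))
  have hB (x : Fin n → I) (t : I) : orbitProj G M (B (x, t)) = b x (intervalToCircle t) := hB (x, t)
  have h01 : intervalToCircle 1 = intervalToCircle 0 := by
    change ((1 : ℝ) : UnitAddCircle) = ((0 : ℝ) : UnitAddCircle)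
    simp
  have hg (x : Fin n → I) : ∃ g : G, g • B (x, 0) = B (x, 1) :=
    hM.apply_eq_iff_mem_orbit.1 (by rw [hB, hB, h01])
  choose g hg using hg
  -- For `y` near `x`, `g y * (g x)⁻¹` carries `g x • B (y, 0)` to `B (y, 1)`, both in a wandering
  -- neighbourhood of `B (x, 1)`, so it is `1`.
  have hloc : IsLocallyConstant g := by
    rw [IsLocallyConstant.iff_eventually_eq]
    intro x
    obtain ⟨U, hU, hgU⟩ := hM.disjoint (B (x, 1))
    have c0 : Continuous fun y => g x • B (y, 0) := by fun_prop
    have c1 : Continuous fun y => B (y, 1) := by fun_prop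
    filter_upwards [c1.continuousAt.preimage_mem_nhds hU,
      c0.continuousAt.preimage_mem_nhds ((hg x).symm ▸ hU)] with y h1 h0
    refine mul_inv_eq_one.1 (hgU (g y * (g x)⁻¹) ⟨_, ⟨_, h0, rfl⟩, ?_⟩)
    simpa [mul_smul, hg] using h1
  refine ⟨ofUncurry (g 0) B fun x => ?_, fun x => ?_⟩
  · rw [hloc.apply_eq_of_preconnectedSpace 0 x, hg]
  · ext s
    obtain ⟨t, rfl⟩ := intervalToCircle_surjective s
    rw [toLoop_apply]
    exact hB x t

/-- Lifting cubes of twisted paths in `M` to cubes of twisted paths in `E × M`, for contractible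
`E`. -/
theorem cubeLifting_snd {E : Type*} [TopologicalSpace E] [MulAction G E]
    [ContinuousConstSMul G E] [ContractibleSpace E] :
    CubeLifting (map ContinuousMap.snd fun _ _ => rfl :
      C(TwistedPathSpace G (E × M), TwistedPathSpace G M)) where
  surjective x := by
    obtain ⟨e⟩ : Nonempty E := inferInstance
    obtain ⟨γ⟩ := PathConnectedSpace.joined e (x.1 • e)
    refine ⟨⟨x.1, ⟨γ.toContinuousMap.prodMk x.path, ?_⟩⟩, rfl⟩
    exact Prod.ext (γ.target.trans (congrArg (x.1 • ·) γ.source.symm)) x.path_one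
  exists_lift n a b ha hab := by
    classical
    -- With `G` discrete, the group element of `b x` is continuous in `x`, hence constant on the
    -- cube.
    let : TopologicalSpace G := ⊥
    have : DiscreteTopology G := ⟨rfl⟩
    have hb : ∀ x, (b x).1 = (b 0).1 := fun x =>
      (IsLocallyConstant.iff_continuous _).2 (continuous_fst.comp b.continuous)
        |>.apply_eq_of_preconnectedSpace x 0
    set g := (b 0).1
    have ha1 : ∀ x ∈ Cube.boundary (Fin n), (a x).1 = g := fun x hx =>
      (congrArg Sigma.fst (hab x hx)).trans (hb x)
    have ha2 : ∀ x ∈ Cube.boundary (Fin n), ∀ t, ((a x).path t).2 = (b x).path t := fun x hx t =>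
      congrArg (fun y : TwistedPathSpace G M => y.path t) (hab x hx)
    have hpath : ContinuousOn (fun z : I × (Fin n → I) => ((a z.2).path z.1).1)
        {z | z.2 ∈ Cube.boundary (Fin n)} :=
      (_root_.continuous_fst.comp continuous_eval_uncurry).comp_continuousOn
        ((ha.comp continuous_snd.continuousOn fun _ h => h).prodMk continuousOn_fst)
    -- The twist condition ties the two ends of the prism together. The starting points are
    -- therefore extended over the cube first, and `g • v` is then imposed as end points.
    obtain ⟨v, hv⟩ := exists_extension_of_contractible (fun x => ((a x).path 0).1)
      (hpath.comp (continuous_const.prodMk continuous_id).continuousOn fun _ h => h)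
    let u : I × (Fin n → I) → E := fun z =>
      if z.2 ∈ Cube.boundary (Fin n) then ((a z.2).path z.1).1
      else if z.1 = 0 then v z.2 else g • v z.2
    have u0 (x) : u (0, x) = v x := by
      by_cases hx : x ∈ Cube.boundary (Fin n)
      · simp only [u, if_pos hx, hv x hx]
      · simp [u, if_neg hx]
    have u1 (x) : u (1, x) = g • v x := by
      by_cases hx : x ∈ Cube.boundary (Fin n)
      · simp only [u, if_pos hx, hv x hx, path_one, ha1 x hx, Prod.smul_fst]
      · simp [u, if_neg hx]
    obtain ⟨U, hU⟩ := exists_extension_prism u <| by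
      refine continuousOn_prismBoundary ?_ ?_ (hpath.congr fun z hz => if_pos hz)
      · simpa only [u0] using v.continuous
      · simp only [u1]
        fun_prop
    have hUb : ∀ x ∈ Cube.boundary (Fin n), ∀ t, U (t, x) = ((a x).path t).1 := fun x hx t =>
      (hU (t, x) (.inr hx)).trans (if_pos hx)
    have hc : Continuous fun z : (Fin n → I) × I => (b z.1).path z.2 :=
      continuous_eval_uncurry.comp ((b.continuous.comp _root_.continuous_fst).prodMk continuous_snd)
    let c : C((Fin n → I) × I, E × M) :=
      ⟨fun z => (U (z.2, z.1), (b z.1).path z.2), by fun_prop⟩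
    refine ⟨ofUncurry g c fun x => ?_,
      fun x hx => ext (ha1 x hx).symm fun t => Prod.ext (hUb x hx t) (ha2 x hx t).symm,
      fun x => ext (hb x).symm fun t => rfl⟩
    refine Prod.ext ?_ ?_
    · change U (1, x) = g • U (0, x)
      rw [hU (1, x) (.inl (.inr rfl)), hU (0, x) (.inl (.inl rfl)), u0, u1]
    · exact (b x).path_one.trans (by rw [hb x]; rfl)

end TwistedPathSpace

/-- The `E`-component of the lift is that of `b`. -/
theorem CubeLifting.prodMap_id {X Y : Type*} [TopologicalSpace X] [TopologicalSpace Y]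
    {f : C(X, Y)} (hf : CubeLifting f) (E : Type*) [TopologicalSpace E] :
    CubeLifting ((ContinuousMap.id E).prodMap f) where
  surjective := Function.surjective_id.prodMap hf.surjective
  exists_lift n a b ha hab := by
    obtain ⟨c, hc, hfc⟩ := hf.exists_lift n (fun x => (a x).2) (ContinuousMap.snd.comp b) ha.snd
      fun x hx => congrArg Prod.snd (hab x hx)
    exact ⟨(ContinuousMap.fst.comp b).prodMk c,
      fun x hx => Prod.ext (congrArg Prod.fst (hab x hx)).symm (hc x hx),
      fun x => Prod.ext rfl (hfc x)⟩

/-! ### The comparison maps -/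

section

variable {G : Type*} [Group G] {E : Type*} [TopologicalSpace E] [MulAction G E]
  [ContinuousConstSMul G E] {M : Type*} [TopologicalSpace M] [MulAction G M]
  [ContinuousConstSMul G M]

/-- Here `F` is the projection `E × 𝒫_G(M) → 𝒫_G(M)` and `π` is `toLoop`. Contractibility of `E`
gives lifting for `F`; freeness comes from `M`. -/
theorem isWeakHomotopyEquiv_borelToLoop [ContractibleSpace E] (hM : IsPrincipalBundle G M) :
    IsWeakHomotopyEquiv (borelToLoop G E M) :=
  ((TwistedPathSpace.hasWanderingNhds hM.disjoint).cubeLifting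
    (CubeLifting.snd (E := E) (TwistedPathSpace G M)) (fun _ _ => rfl)
    (TwistedPathSpace.toLoop_eq_iff hM) (TwistedPathSpace.exists_lift_toLoop hM)
    fun _ => rfl).isWeakHomotopyEquiv

/-- Freeness now comes from the factor `E`, so cubes lift through the covering `E × 𝒫_G(M) → E ×_G
𝒫_G(M)`, whatever the action on `M`. -/
theorem isWeakHomotopyEquiv_borelTwistedSnd (hE : IsUniversalBundle G E) :
    IsWeakHomotopyEquiv (borelTwistedSnd G E M) := by
  have := hE.contractible
  have hW : HasWanderingNhds G (E × TwistedPathSpace G M) :=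
    HasWanderingNhds.of_equivariant hE.isPrincipalBundle.disjoint ContinuousMap.fst fun _ _ => rfl
  exact (hW.cubeLifting ((TwistedPathSpace.cubeLifting_snd (M := M) (E := E)).prodMap_id E)
    (fun _ _ => rfl) (π := orbitProj G (E × TwistedPathSpace G M)) (fun _ _ => Quotient.eq)
    (fun _ b => hW.isPrincipalBundle.isCoveringMap.exists_lift_cube
      hW.isPrincipalBundle.surjective b) fun _ => rfl).isWeakHomotopyEquiv

end

theorem propositionA1 {G : Type*} [Group G]
    {E : Type*} [TopologicalSpace E] [MulAction G E] [ContinuousConstSMul G E]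
    (hE : IsUniversalBundle G E)
    {M : Type*} [TopologicalSpace M] [MulAction G M] [ContinuousConstSMul G M] :
    (IsPrincipalBundle G M → IsWeakHomotopyEquiv (borelToLoop G E M)) ∧
    (IsWeakHomotopyEquiv (borelTwistedSnd G E M) ∧
      IsWeakHomotopyEquiv (borelToLoop G E (E × M))) := by
  have := hE.contractible
  refine ⟨isWeakHomotopyEquiv_borelToLoop, isWeakHomotopyEquiv_borelTwistedSnd hE,
    isWeakHomotopyEquiv_borelToLoop (HasWanderingNhds.isPrincipalBundle ?_)⟩
  exact HasWanderingNhds.of_equivariant hE.isPrincipalBundle.disjoint ContinuousMap.fst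
    fun _ _ => rfl
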